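/- Let $k$ be an algebraically closed field (of arbitrary characteristic) and let $A = k[X,Y]$ be the polynomial ring in two variables over $k$. For $G \in A$, say that $A/(G)$ is *$k$-rational* if $G$ is an irreducible element of $A$ and the field of fractions of $A/(G)$ is isomorphic, as an extension of $k$, to the rational function field $k(T)$ in one variable. Then for every $F \in A$ the following conditions are equivalent: 1. $A/(F-\lambda)$ is $k$-rational for infinitely many $\lambda \in k$; 2. $A/(F-\lambda)$ is $k$-rational for all but finitely many $\lambda \in k$. -/

import Mathlib

/-
By Lüroth's theorem, an irreducible plane curve `G = 0` is rational if and only if it has a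
nonconstant rational parametrization, and a birational one has degree at most `deg G`: the degree of
`y ∈ k(T)` is `[k(T) : k(y)]`, and `G` gives an equation over `k(y)` for the other coordinate, which
generates `k(T)`. Together with a bound on the degrees of the factors of a reducible `G`, this
expresses rationality by polynomial conditions on the coefficients of `G` and finitely many
auxiliary unknowns. By Chevalley's theorem, the rational members of an algebraic family of plane
curves then form a constructible set of parameters, and a constructible subset of the affine line is
finite or cofinite.
-/

/-- For a field `k` and `F` in the polynomial ring `A = k[X, Y]`: the quotient `A/(F)` is
`k`-rational, i.e. `F` is an irreducible element of `A` and the field of fractions of `A/(F)` is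
isomorphic, as an extension of `k`, to the rational function field `k(T)` in one variable. -/
def IsRationalQuotient {k : Type*} [Field k] (F : MvPolynomial (Fin 2) k) : Prop :=
  Irreducible F ∧
    Nonempty (FractionRing (MvPolynomial (Fin 2) k ⧸ Ideal.span {F}) ≃ₐ[k] RatFunc k)

section ClosedPoints

open PrimeSpectrum Topology

variable {k R A : Type*} [Field k] [CommRing R] [Algebra k R] [CommRing A] [Algebra k A]

theorem algHom_eq_of_ker_le {φ ψ : R →ₐ[k] k} (h : RingHom.ker φ ≤ RingHom.ker ψ) : φ = ψ := by
  ext r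
  have : ψ (r - algebraMap k R (φ r)) = 0 := h (by simp [RingHom.mem_ker])
  rw [map_sub, AlgHom.commutes, sub_eq_zero] at this
  exact this.symm

theorem exists_algHom_ker_eq_of_isMaximal [IsAlgClosed k] [Algebra.FiniteType k A]
    (m : Ideal A) [m.IsMaximal] : ∃ ψ : A →ₐ[k] k, RingHom.ker ψ = m := by
  let := Ideal.Quotient.field m
  have := finite_of_finite_type_of_isJacobsonRing k (A ⧸ m)
  let e := AlgEquiv.ofBijective (Algebra.ofId k (A ⧸ m))
    IsAlgClosed.algebraMap_bijective_of_isIntegral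
  refine ⟨(e.symm : (A ⧸ m) →ₐ[k] k).comp (Ideal.Quotient.mkₐ k m), ?_⟩
  ext a
  simp [RingHom.mem_ker, Ideal.Quotient.eq_zero_iff_mem]

/-- The kernel of a homomorphism `ψ : R →ₐ[k] k`, as a point of `Spec R`. -/
def kernelPoint (ψ : R →ₐ[k] k) : PrimeSpectrum R :=
  ⟨RingHom.ker ψ, RingHom.ker_isPrime ψ⟩

theorem kernelPoint_injective : Function.Injective (kernelPoint : (R →ₐ[k] k) → PrimeSpectrum R) :=
  fun _ _ h => algHom_eq_of_ker_le (congrArg PrimeSpectrum.asIdeal h).le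

theorem comap_kernelPoint (φ : R →ₐ[k] A) (χ : A →ₐ[k] k) :
    comap (φ : R →+* A) (kernelPoint χ) = kernelPoint (χ.comp φ) := rfl

theorem isClosed_singleton_kernelPoint (ψ : R →ₐ[k] k) : IsClosed {kernelPoint ψ} :=
  (isClosed_singleton_iff_isMaximal _).2 <|
    RingHom.ker_isMaximal_of_surjective ψ fun a => ⟨algebraMap k R a, by simp⟩

theorem exists_kernelPoint_mem_of_isLocallyClosed [IsAlgClosed k] [Algebra.FiniteType k A]
    {Z : Set (PrimeSpectrum A)} (hZ : IsLocallyClosed Z) (hne : Z.Nonempty) :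
    ∃ χ : A →ₐ[k] k, kernelPoint χ ∈ Z := by
  have : IsJacobsonRing A := isJacobsonRing_of_finiteType (A := k)
  obtain ⟨z, hzZ, hz⟩ := nonempty_inter_closedPoints hne hZ
  have : z.asIdeal.IsMaximal := (isClosed_singleton_iff_isMaximal z).1 hz
  obtain ⟨χ, hχ⟩ := exists_algHom_ker_eq_of_isMaximal (k := k) z.asIdeal
  have : kernelPoint χ = z := PrimeSpectrum.ext hχ
  exact ⟨χ, this ▸ hzZ⟩

theorem exists_kernelPoint_mem_of_isConstructible [IsAlgClosed k] [Algebra.FiniteType k A]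
    {Z : Set (PrimeSpectrum A)} (hZ : IsConstructible Z) (hne : Z.Nonempty) :
    ∃ χ : A →ₐ[k] k, kernelPoint χ ∈ Z := by
  obtain ⟨S, rfl⟩ := exists_constructibleSetData_iff.2 hZ
  obtain ⟨z, hz⟩ := hne
  obtain ⟨C, hC, hzC⟩ := Set.mem_iUnion₂.1 hz
  obtain ⟨χ, hχ⟩ := exists_kernelPoint_mem_of_isLocallyClosed (k := k)
    ((isClosed_zeroLocus (Set.range C.g)).isLocallyClosed.inter
      (isClosed_zeroLocus {C.f}).isOpen_compl.isLocallyClosed) ⟨z, hzC⟩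
  exact ⟨χ, Set.mem_iUnion₂.2 ⟨C, hC, hχ⟩⟩

/-- A constructible set of `k`-rational points of the affine scheme `Spec R`, the points being
encoded as homomorphisms `R →ₐ[k] k`. -/
def IsConstructibleLocus (S : Set (R →ₐ[k] k)) : Prop :=
  ∃ Z : Set (PrimeSpectrum R), IsConstructible Z ∧ kernelPoint ⁻¹' Z = S

namespace IsConstructibleLocus

variable {S T : Set (R →ₐ[k] k)}

theorem compl (hS : IsConstructibleLocus S) : IsConstructibleLocus Sᶜ := by
  obtain ⟨Z, hZ, rfl⟩ := hS
  exact ⟨Zᶜ, isConstructible_compl.2 hZ, rfl⟩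

theorem inter (hS : IsConstructibleLocus S) (hT : IsConstructibleLocus T) :
    IsConstructibleLocus (S ∩ T) := by
  obtain ⟨Z, hZ, rfl⟩ := hS
  obtain ⟨W, hW, rfl⟩ := hT
  exact ⟨Z ∩ W, hZ.inter hW, rfl⟩

theorem iInter {ι : Type*} [Finite ι] {S : ι → Set (R →ₐ[k] k)}
    (hS : ∀ i, IsConstructibleLocus (S i)) : IsConstructibleLocus (⋂ i, S i) := by
  choose Z hZ hZS using hS
  exact ⟨⋂ i, Z i, .iInter hZ, by simp only [Set.preimage_iInter, hZS]⟩

/-- Chevalley's theorem for `k`-rational points: by the Nullstellensatz, the fibre of a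
constructible set over a `k`-rational point contains a `k`-rational point if it is nonempty. -/
theorem image_comp [IsAlgClosed k] [Algebra.FiniteType k R] [Algebra.FiniteType k A]
    (φ : R →ₐ[k] A) {S : Set (A →ₐ[k] k)} (hS : IsConstructibleLocus S) :
    IsConstructibleLocus ((fun χ => χ.comp φ) '' S) := by
  obtain ⟨Z, hZ, rfl⟩ := hS
  have := Algebra.FiniteType.isNoetherianRing k R
  have := Algebra.FiniteType.isNoetherianRing k A
  have hφ : (φ : R →+* A).FinitePresentation :=
    RingHom.FinitePresentation.of_finiteType.1 <|
      RingHom.FiniteType.of_comp_finiteType (f := algebraMap k R) <| by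
        rw [φ.comp_algebraMap, RingHom.finiteType_algebraMap]
        infer_instance
  refine ⟨comap (φ : R →+* A) '' Z, isConstructible_comap_image hφ hZ, ?_⟩
  ext ψ
  constructor
  · rintro ⟨z, hz, hzψ⟩
    have hfibre : IsConstructible (comap (φ : R →+* A) ⁻¹' {kernelPoint ψ}) := by
      rw [← isConstructible_compl]
      exact (TopologicalSpace.NoetherianSpace.isCompact _).isConstructible
        ((isClosed_singleton_kernelPoint ψ).preimage (continuous_comap _)).isOpen_compl
    obtain ⟨χ, hχZ, hχψ⟩ :=
      exists_kernelPoint_mem_of_isConstructible (k := k) (hZ.inter hfibre) ⟨z, hz, hzψ⟩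
    exact ⟨χ, hχZ, kernelPoint_injective hχψ⟩
  · rintro ⟨χ, hχ, rfl⟩
    exact ⟨kernelPoint χ, hχ, comap_kernelPoint φ χ⟩

end IsConstructibleLocus

theorem isConstructibleLocus_setOf_forall_eq_zero [IsNoetherianRing R] {ι : Sort*} (r : ι → R) :
    IsConstructibleLocus {ψ : R →ₐ[k] k | ∀ i, ψ (r i) = 0} := by
  refine ⟨zeroLocus (Set.range r), ?_, ?_⟩
  · rw [← isConstructible_compl]
    exact (TopologicalSpace.NoetherianSpace.isCompact _).isConstructible
      (isClosed_zeroLocus _).isOpen_compl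
  · ext ψ
    exact Set.range_subset_iff

theorem IsConstructibleLocus.finite_or_finite_compl {S : Set (Polynomial k →ₐ[k] k)}
    (hS : IsConstructibleLocus S) :
    {c : k | Polynomial.aeval c ∈ S}.Finite ∨ {c : k | Polynomial.aeval c ∉ S}.Finite := by
  obtain ⟨Z, hZ, rfl⟩ := hS
  induction hZ using IsConstructible.empty_union_induction with
  | open_retrocompact U hU _ =>
    obtain ⟨s, hs⟩ := (isOpen_iff U).1 hU
    by_cases h : ∃ f ∈ s, f ≠ 0
    · obtain ⟨f, hfs, hf⟩ := h
      have hroots : {c | f.IsRoot c}.Finite :=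
        Set.not_infinite.1 (mt f.eq_zero_of_infinite_isRoot hf)
      exact .inr (hroots.subset fun c hc => (hs.le hc : s ⊆ _) hfs)
    · push Not at h
      refine .inl (Set.finite_empty.subset fun c hc => ?_)
      exact hs.ge (fun f hf => by simp [h f hf]) hc
  | union Z _ W _ hZ hW =>
    rcases hZ with hZ | hZ
    · rcases hW with hW | hW
      · exact .inl (hZ.union hW)
      · exact .inr (hW.subset fun c hc => mt .inr hc)
    · exact .inr (hZ.subset fun c hc => mt .inl hc)
  | compl s _ hs => exact hs.symm.imp (by simp) (by simp)

end ClosedPoints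

section Projections

variable {k R : Type*} [Field k] [CommRing R] [Algebra k R] {ι τ : Type*}

theorem IsConstructibleLocus.setOf_exists_aevalTower [IsAlgClosed k] [Algebra.FiniteType k R]
    [Finite ι] {S : Set (MvPolynomial ι R →ₐ[k] k)} (hS : IsConstructibleLocus S) :
    IsConstructibleLocus {ψ : R →ₐ[k] k | ∃ x : ι → k, MvPolynomial.aevalTower ψ x ∈ S} := by
  have : Algebra.FiniteType k (MvPolynomial ι R) := .trans ‹_› inferInstance
  convert hS.image_comp (IsScalarTower.toAlgHom k R (MvPolynomial ι R)) using 1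
  ext ψ
  constructor
  · rintro ⟨x, hx⟩
    exact ⟨_, hx, MvPolynomial.aevalTower_comp_toAlgHom ψ x⟩
  · rintro ⟨χ, hχ, rfl⟩
    refine ⟨fun i => χ (MvPolynomial.X i), ?_⟩
    convert hχ
    ext i
    · simp
    · simp

theorem map_C_map_aevalTower (F : MvPolynomial τ R) (ψ : R →ₐ[k] k) (x : ι → k) :
    (F.map MvPolynomial.C).map (MvPolynomial.aevalTower ψ x : MvPolynomial ι R →+* k) =
      F.map (ψ : R →+* k) := by
  rw [MvPolynomial.map_map, MvPolynomial.aevalTower_comp_C]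

end Projections

section GenericPolynomials

open MvPolynomial

variable {k : Type*} (R : Type*) [CommRing R] {σ τ : Type*} (d : ℕ)

/-- The family of generic polynomials of degree at most `d` indexed by `σ`: the coefficients of
all of them are independent variables. -/
noncomputable def genericPolynomial (s : σ) : Polynomial (MvPolynomial (σ × Fin (d + 1)) R) :=
  ∑ j : Fin (d + 1), .C (X (s, j)) * .X ^ (j : ℕ)

variable (τ) in
/-- The exponents of the monomials of degree at most `d` in the variables `τ`. -/
abbrev BoundedExponent : Type _ := {m : τ →₀ ℕ // m.degree ≤ d}

instance [Finite τ] : Finite (BoundedExponent τ d) := Finsupp.finite_of_degree_le d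

variable (τ) in
/-- The family of generic polynomials in the variables `τ` of total degree at most `d` indexed by
`σ`: the coefficients of all of them are independent variables. The definition is meaningful only
for finite `τ`, since `∑ᶠ` is zero on a family of infinite support. -/
noncomputable def genericMvPolynomial (s : σ) :
    MvPolynomial τ (MvPolynomial (σ × BoundedExponent τ d) R) :=
  ∑ᶠ m : BoundedExponent τ d, monomial m (X (s, m))

variable {R d} [Field k] [Algebra k R]

theorem exists_map_genericPolynomial_iff (ψ : R →ₐ[k] k) {p : (σ → Polynomial k) → Prop} :
    (∃ x : σ × Fin (d + 1) → k, p fun s => (genericPolynomial R d s).map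
      (aevalTower ψ x : MvPolynomial (σ × Fin (d + 1)) R →+* k)) ↔
      ∃ P, (∀ s, (P s).natDegree ≤ d) ∧ p P := by
  constructor
  · rintro ⟨x, hx⟩
    refine ⟨_, fun s => Polynomial.natDegree_map_le.trans ?_, hx⟩
    exact Polynomial.natDegree_sum_le_of_forall_le _ _ fun j _ =>
      (Polynomial.natDegree_C_mul_X_pow_le _ _).trans (Nat.lt_succ_iff.1 j.2)
  · rintro ⟨P, hP, hp⟩
    refine ⟨fun i => (P i.1).coeff i.2, ?_⟩
    convert hp with s
    simp only [genericPolynomial, Polynomial.map_sum, Polynomial.map_mul, Polynomial.map_pow,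
      Polynomial.map_C, Polynomial.map_X, RingHom.coe_coe, aevalTower_X]
    rw [Fin.sum_univ_eq_sum_range fun j => Polynomial.C ((P s).coeff j) * Polynomial.X ^ j]
    exact ((P s).as_sum_range_C_mul_X_pow' (Nat.lt_succ_of_le (hP s))).symm

theorem coeff_genericMvPolynomial [Finite τ] (s : σ) (m : τ →₀ ℕ) :
    (genericMvPolynomial R τ d s).coeff m = if h : m.degree ≤ d then X (s, ⟨m, h⟩) else 0 := by
  classical
  have := Fintype.ofFinite (BoundedExponent τ d)
  rw [genericMvPolynomial, finsum_eq_sum_of_fintype, coeff_sum]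
  simp only [coeff_monomial]
  split_ifs with h
  · rw [Finset.sum_eq_single ⟨m, h⟩] <;> simp +contextual [Subtype.ext_iff]
  · exact Finset.sum_eq_zero fun n _ => if_neg (by grind)

theorem exists_map_genericMvPolynomial_iff [Finite τ] (ψ : R →ₐ[k] k)
    {p : (σ → MvPolynomial τ k) → Prop} :
    (∃ x : σ × BoundedExponent τ d → k, p fun s => (genericMvPolynomial R τ d s).map
      (aevalTower ψ x : MvPolynomial (σ × BoundedExponent τ d) R →+* k)) ↔
      ∃ G, (∀ s, (G s).totalDegree ≤ d) ∧ p G := by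
  constructor
  · rintro ⟨x, hx⟩
    refine ⟨_, fun s => ?_, hx⟩
    refine Finset.sup_le fun m hm => ?_
    change m.degree ≤ d
    by_contra hdm
    rw [mem_support_iff, coeff_map, coeff_genericMvPolynomial, dif_neg hdm, map_zero] at hm
    exact hm rfl
  · rintro ⟨G, hG, hp⟩
    refine ⟨fun i => (G i.1).coeff i.2, ?_⟩
    convert hp with s
    ext m
    rw [coeff_map, coeff_genericMvPolynomial]
    split_ifs with h
    · simp
    · rw [map_zero, eq_comm]
      exact notMem_support_iff.1 fun hm => h ((le_totalDegree hm).trans (hG s))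

end GenericPolynomials

section IrreducibleLocus

open MvPolynomial

variable {k R τ : Type*} [Field k] [CommRing R] [Algebra k R]

theorem totalDegree_eq_zero_iff_coeff_eq_zero {S : Type*} [CommSemiring S] {p : MvPolynomial τ S} :
    p.totalDegree = 0 ↔ ∀ m : {m : τ →₀ ℕ // m ≠ 0}, p.coeff m = 0 := by
  rw [totalDegree_eq_zero_iff]
  constructor
  · exact fun h m => by_contra fun hm => m.2 (Finsupp.ext (h m (mem_support_iff.2 hm)))
  · refine fun h m hm x => by_contra fun hx => mem_support_iff.1 hm (h ⟨m, ?_⟩)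
    rintro rfl
    exact hx rfl

theorem isUnit_iff_totalDegree_eq_zero {p : MvPolynomial τ k} (hp : p ≠ 0) :
    IsUnit p ↔ p.totalDegree = 0 := by
  rw [isUnit_iff_totalDegree_of_isReduced, and_iff_right_iff_imp, isUnit_iff_ne_zero]
  rintro h h0
  rw [totalDegree_eq_zero_iff_eq_C.1 h, h0, map_zero] at hp
  exact hp rfl

theorem not_irreducible_iff_exists_totalDegree_le {p : MvPolynomial τ k} {d : ℕ}
    (hd : p.totalDegree ≤ d) :
    ¬ Irreducible p ↔ p.totalDegree = 0 ∨ ∃ G : Fin 2 → MvPolynomial τ k,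
      (∀ i, (G i).totalDegree ≤ d) ∧ p = G 0 * G 1 ∧ ∀ i, (G i).totalDegree ≠ 0 := by
  rcases eq_or_ne p 0 with rfl | hp
  · simp
  rw [irreducible_iff, isUnit_iff_totalDegree_eq_zero hp, not_and_or, not_not]
  refine or_congr_right ⟨fun h => ?_, ?_⟩
  · push Not at h
    obtain ⟨G, H, rfl, hG, hH⟩ := h
    have hG0 := left_ne_zero_of_mul hp
    have hH0 := right_ne_zero_of_mul hp
    rw [isUnit_iff_totalDegree_eq_zero hG0] at hG
    rw [isUnit_iff_totalDegree_eq_zero hH0] at hH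
    rw [totalDegree_mul_of_isDomain hG0 hH0] at hd
    refine ⟨![G, H], ?_, rfl, ?_⟩ <;> rw [Fin.forall_fin_two]
    · exact ⟨(Nat.le_add_right _ _).trans hd, (Nat.le_add_left _ _).trans hd⟩
    · exact ⟨hG, hH⟩
  · rintro ⟨G, -, rfl, hG⟩ h
    rcases h rfl with h | h
    · exact hG 0 ((isUnit_iff_totalDegree_eq_zero (left_ne_zero_of_mul hp)).1 h)
    · exact hG 1 ((isUnit_iff_totalDegree_eq_zero (right_ne_zero_of_mul hp)).1 h)

theorem isConstructibleLocus_setOf_totalDegree_eq_zero [IsNoetherianRing R] (F : MvPolynomial τ R) :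
    IsConstructibleLocus {ψ : R →ₐ[k] k | (F.map (ψ : R →+* k)).totalDegree = 0} := by
  simpa only [totalDegree_eq_zero_iff_coeff_eq_zero, coeff_map, RingHom.coe_coe] using
    isConstructibleLocus_setOf_forall_eq_zero fun m : {m : τ →₀ ℕ // m ≠ 0} => F.coeff m

theorem isConstructibleLocus_setOf_map_eq_map [IsNoetherianRing R] (F G : MvPolynomial τ R) :
    IsConstructibleLocus {ψ : R →ₐ[k] k | F.map (ψ : R →+* k) = G.map (ψ : R →+* k)} := by
  simpa [MvPolynomial.ext_iff, coeff_map, sub_eq_zero] using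
    isConstructibleLocus_setOf_forall_eq_zero (k := k) fun m => F.coeff m - G.coeff m

theorem totalDegree_map_le {S T : Type*} [CommSemiring S] [CommSemiring T] (f : S →+* T)
    (F : MvPolynomial τ S) :
    (F.map f).totalDegree ≤ F.totalDegree :=
  Finset.sup_mono (support_map_subset f F)

theorem isConstructibleLocus_setOf_irreducible_map [IsAlgClosed k] [Algebra.FiniteType k R]
    [Finite τ] (F : MvPolynomial τ R) :
    IsConstructibleLocus {ψ : R →ₐ[k] k | Irreducible (F.map (ψ : R →+* k))} := by
  let σ := Fin 2 × BoundedExponent τ F.totalDegree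
  have := Algebra.FiniteType.isNoetherianRing k R
  let G : Fin 2 → MvPolynomial τ (MvPolynomial σ R) := genericMvPolynomial R τ F.totalDegree
  have hfactor : IsConstructibleLocus {ψ : R →ₐ[k] k | ∃ G : Fin 2 → MvPolynomial τ k,
      (∀ i, (G i).totalDegree ≤ F.totalDegree) ∧ F.map (ψ : R →+* k) = G 0 * G 1 ∧
        ∀ i, (G i).totalDegree ≠ 0} := by
    have heq := isConstructibleLocus_setOf_map_eq_map (k := k) (F.map C) (G 0 * G 1)
    have hdeg i := (isConstructibleLocus_setOf_totalDegree_eq_zero (k := k) (G i)).compl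
    convert (heq.inter (.iInter hdeg)).setOf_exists_aevalTower using 3 with ψ
    rw [← exists_map_genericMvPolynomial_iff ψ]
    simp [σ, G, map_C_map_aevalTower]
  convert ((isConstructibleLocus_setOf_totalDegree_eq_zero F).compl.inter hfactor.compl) using 1
  ext ψ
  rw [Set.mem_ofPred_eq, ← not_not (a := Irreducible _),
    not_irreducible_iff_exists_totalDegree_le (totalDegree_map_le _ F), not_or]
  rfl

end IrreducibleLocus

section ParametrizationLocus

open MvPolynomial
open scoped Polynomial

variable {k R σ : Type*} [Field k] [CommRing R]

/-- The homogenization of `F`, with the homogenizing variable `X none`. It clears denominators in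
the equation `F = 0` for a point with coordinates in a field of fractions. -/
noncomputable def homogenization {S : Type*} [CommSemiring S] (F : MvPolynomial σ S) :
    MvPolynomial (Option σ) S :=
  ∑ m ∈ F.support, rename some (monomial m (F.coeff m)) * X none ^ (F.totalDegree - m.degree)

theorem eval₂_homogenization {S L : Type*} [CommSemiring S] [Field L] (f : S →+* L)
    (F : MvPolynomial σ S) {P : Option σ → L} (h : P none ≠ 0) :
    eval₂ f P (homogenization F) =
      eval₂ f (fun i => P (some i) / P none) F * P none ^ F.totalDegree := by
  rw [homogenization, eval₂_sum, eval₂_eq, Finset.sum_mul]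
  refine Finset.sum_congr rfl fun m hm => ?_
  have hm : m.degree ≤ F.totalDegree := le_totalDegree hm
  rw [eval₂_mul, eval₂_rename, eval₂_monomial, eval₂_pow, eval₂_X, mul_assoc, mul_assoc]
  congr 1
  simp only [Finsupp.prod, Function.comp_apply, div_pow, Finset.prod_div_distrib,
    Finset.prod_pow_eq_pow_sum]
  rw [← Finsupp.degree_apply, div_mul_eq_mul_div, mul_div_assoc, pow_sub₀ _ h hm, div_eq_mul_inv]

/-- The point of the affine chart `X none ≠ 0` of projective space, over the function field `k(T)`,
with homogeneous coordinates `P`. It is the origin if `P none = 0`. -/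
noncomputable def affineCoordinates (P : Option σ → k[X]) (i : σ) : RatFunc k :=
  algebraMap k[X] (RatFunc k) (P (some i)) / algebraMap k[X] (RatFunc k) (P none)

/-- `x` is a nonconstant point over `k(T)` of the affine hypersurface `G = 0`, that is, a rational
parametrization of a curve contained in it. -/
def IsRationalParametrization (G : MvPolynomial σ k) (x : σ → RatFunc k) : Prop :=
  aeval x G = 0 ∧ ∃ i, x i ∉ (algebraMap k (RatFunc k)).range

theorem algebraMap_div_mem_range_iff {p q : k[X]} :
    algebraMap k[X] (RatFunc k) p / algebraMap k[X] (RatFunc k) q ∈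
      (algebraMap k (RatFunc k)).range ↔
    ∀ a b, p.coeff a * q.coeff b - p.coeff b * q.coeff a = 0 := by
  rcases eq_or_ne q 0 with rfl | hq
  · simp
  have hq' : algebraMap k[X] (RatFunc k) q ≠ 0 := RatFunc.algebraMap_ne_zero hq
  have mem_iff : algebraMap k[X] (RatFunc k) p / algebraMap k[X] (RatFunc k) q ∈
      (algebraMap k (RatFunc k)).range ↔ ∃ c, .C c * q = p := by
    refine exists_congr fun c => ?_
    rw [eq_div_iff hq', IsScalarTower.algebraMap_apply k k[X] (RatFunc k),
      Polynomial.algebraMap_eq, ← map_mul, (RatFunc.algebraMap_injective k).eq_iff]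
  rw [mem_iff]
  constructor
  · rintro ⟨c, rfl⟩ a b
    simp only [Polynomial.coeff_C_mul]
    ring
  · intro h
    refine ⟨p.coeff q.natDegree / q.leadingCoeff, Polynomial.ext fun j => ?_⟩
    have hlead : q.leadingCoeff ≠ 0 := Polynomial.leadingCoeff_ne_zero.2 hq
    rw [Polynomial.coeff_C_mul]
    field_simp
    rw [Polynomial.leadingCoeff]
    linear_combination h q.natDegree j

theorem isRationalParametrization_affineCoordinates_iff (ψ : R →+* k) (F : MvPolynomial σ R)
    {P : Option σ → k[X]} :
    IsRationalParametrization (F.map ψ) (affineCoordinates P) ↔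
      eval₂ (Polynomial.C.comp ψ) P (homogenization F) = 0 ∧
        ¬ ∀ i a b, (P (some i)).coeff a * (P none).coeff b -
          (P (some i)).coeff b * (P none).coeff a = 0 := by
  rw [IsRationalParametrization, ← not_forall_not]
  simp only [not_not, affineCoordinates, algebraMap_div_mem_range_iff]
  refine and_congr_left fun h => ?_
  have hP : algebraMap k[X] (RatFunc k) (P none) ≠ 0 := by
    refine RatFunc.algebraMap_ne_zero fun h0 => h ?_
    simp [h0]
  rw [← (RatFunc.algebraMap_injective k).eq_iff, map_zero, hom_eval₂]
  rw [eval₂_homogenization _ _ hP, mul_eq_zero, or_iff_left (pow_ne_zero _ hP), aeval_def,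
    eval₂_map, ← RingHom.comp_assoc, ← Polynomial.algebraMap_eq, ← IsScalarTower.algebraMap_eq]
  rfl

variable [Algebra k R]

theorem isConstructibleLocus_setOf_isRationalParametrization_map [IsNoetherianRing R]
    (F : MvPolynomial σ R) (P : Option σ → R[X]) :
    IsConstructibleLocus {ψ : R →ₐ[k] k | IsRationalParametrization (F.map (ψ : R →+* k))
      (affineCoordinates fun s => (P s).map (ψ : R →+* k))} := by
  simp only [isRationalParametrization_affineCoordinates_iff]
  have hzero := isConstructibleLocus_setOf_forall_eq_zero (k := k)
    (eval₂ Polynomial.C P (homogenization F)).coeff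
  have hconst := isConstructibleLocus_setOf_forall_eq_zero (k := k)
    fun s : σ × ℕ × ℕ => (P (some s.1)).coeff s.2.1 * (P none).coeff s.2.2 -
          (P (some s.1)).coeff s.2.2 * (P none).coeff s.2.1
  convert hzero.inter hconst.compl using 1
  ext ψ
  have hmap : (eval₂ Polynomial.C P (homogenization F)).map (ψ : R →+* k) =
      eval₂ (Polynomial.C.comp ψ) (fun s => (P s).map (ψ : R →+* k)) (homogenization F) := by
    rw [← Polynomial.coe_mapRingHom, hom_eval₂, Polynomial.mapRingHom_comp_C]
  rw [Set.mem_ofPred_eq, ← hmap, Polynomial.ext_iff]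
  simp [Polynomial.coeff_map]

theorem isConstructibleLocus_setOf_exists_isRationalParametrization [IsAlgClosed k]
    [Algebra.FiniteType k R] [Finite σ] (F : MvPolynomial σ R) (d : ℕ) :
    IsConstructibleLocus {ψ : R →ₐ[k] k | ∃ P : Option σ → k[X], (∀ s, (P s).natDegree ≤ d) ∧
      IsRationalParametrization (F.map (ψ : R →+* k)) (affineCoordinates P)} := by
  have := Algebra.FiniteType.isNoetherianRing k R
  convert (isConstructibleLocus_setOf_isRationalParametrization_map (k := k) (F.map C)
    (genericPolynomial R d)).setOf_exists_aevalTower using 3 with ψ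
  rw [← exists_map_genericPolynomial_iff ψ]
  simp [map_C_map_aevalTower]

end ParametrizationLocus

section PlaneCurves

open MvPolynomial
open scoped IntermediateField Polynomial

variable {k : Type*} [Field k]

theorem krullDimLE_quotient_span_singleton {n : ℕ} {G : MvPolynomial (Fin (n + 1)) k}
    (hG : G ≠ 0) :
    Ring.KrullDimLE n (MvPolynomial (Fin (n + 1)) k ⧸ Ideal.span {G}) := by
  have h := ringKrullDim_quotient_succ_le_of_nonZeroDivisor (mem_nonZeroDivisors_of_ne_zero hG)
  rw [MvPolynomial.ringKrullDim_of_isNoetherianRing, ringKrullDim_eq_zero_of_field, zero_add,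
    Nat.card_fin, Nat.cast_add, Nat.cast_one] at h
  exact (Order.krullDimLE_iff _ _).2 ((ENat.WithBot.add_le_add_one_right_iff).1 h)

theorem injective_of_apply_notMem_range [IsAlgClosed k] {A L : Type*} [CommRing A] [IsDomain A]
    [Algebra k A] [Algebra.FiniteType k A] [Ring.KrullDimLE 1 A] [CommRing L] [IsDomain L]
    [Algebra k L] (f : A →ₐ[k] L) {a : A} (ha : f a ∉ (algebraMap k L).range) :
    Function.Injective f := by
  rw [RingHom.injective_iff_ker_eq_bot]
  by_contra hne
  -- a nonzero kernel is maximal, hence the kernel of a `k`-point `ψ`, and `f` factors through `ψ`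
  have := Ring.krullDimLE_one_iff_of_noZeroDivisors.1 ‹_› _ hne (RingHom.ker_isPrime f)
  obtain ⟨ψ, hψ⟩ := exists_algHom_ker_eq_of_isMaximal (k := k) (RingHom.ker f)
  have hmem : a - algebraMap k A (ψ a) ∈ RingHom.ker ψ := by simp [RingHom.mem_ker]
  rw [hψ, RingHom.mem_ker, map_sub, AlgHom.commutes, sub_eq_zero] at hmem
  exact ha ⟨ψ a, hmem.symm⟩

theorem nonempty_fractionRing_algEquiv_ratFunc {B : Type*} [CommRing B] [IsDomain B]
    [Algebra k B] {f : B →ₐ[k] RatFunc k} (hf : Function.Injective f) {b : B}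
    (hb : f b ∉ (algebraMap k (RatFunc k)).range) :
    Nonempty (FractionRing B ≃ₐ[k] RatFunc k) := by
  let g : FractionRing B →ₐ[k] RatFunc k := IsFractionRing.liftAlgHom (g := f) hf
  have hg : g.fieldRange ≠ ⊥ := by
    intro h
    have hmem : f b ∈ g.fieldRange := ⟨algebraMap _ _ b, IsFractionRing.lift_algebraMap hf b⟩
    rw [h, IntermediateField.mem_bot] at hmem
    exact hb hmem
  exact ⟨(AlgEquiv.ofInjectiveField g).trans (RatFunc.Luroth.algEquiv hg).symm⟩

theorem IsRationalParametrization.isRationalQuotient [IsAlgClosed k]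
    {G : MvPolynomial (Fin 2) k} {x : Fin 2 → RatFunc k} (hx : IsRationalParametrization G x)
    (hG : Irreducible G) : IsRationalQuotient G := by
  refine ⟨hG, ?_⟩
  have : (Ideal.span {G}).IsPrime := (Ideal.span_singleton_prime hG.ne_zero).2 hG.prime
  have := krullDimLE_quotient_span_singleton hG.ne_zero
  let f : (MvPolynomial (Fin 2) k ⧸ Ideal.span {G}) →ₐ[k] RatFunc k :=
    Ideal.Quotient.liftₐ (Ideal.span {G}) (aeval x) fun a ha => by
      obtain ⟨b, rfl⟩ := Ideal.mem_span_singleton.1 ha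
      rw [map_mul, hx.1, zero_mul]
  obtain ⟨i, hi⟩ := hx.2
  have hfi : f (Ideal.Quotient.mk _ (X i)) ∉ (algebraMap k (RatFunc k)).range := by
    have : f (Ideal.Quotient.mk _ (X i)) = x i := aeval_X x i
    rwa [this]
  exact nonempty_fractionRing_algEquiv_ratFunc (injective_of_apply_notMem_range f hfi) hfi

theorem IsRationalQuotient.exists_aeval_eq_zero_and_adjoin_eq_top
    {G : MvPolynomial (Fin 2) k} (h : IsRationalQuotient G) :
    ∃ x : Fin 2 → RatFunc k, aeval x G = 0 ∧ IntermediateField.adjoin k (Set.range x) = ⊤ := by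
  obtain ⟨hG, ⟨e⟩⟩ := h
  have : (Ideal.span {G}).IsPrime := (Ideal.span_singleton_prime hG.ne_zero).2 hG.prime
  let B := MvPolynomial (Fin 2) k ⧸ Ideal.span {G}
  let g : B →ₐ[k] RatFunc k :=
    (e : FractionRing B →ₐ[k] RatFunc k).comp (IsScalarTower.toAlgHom k B (FractionRing B))
  let x : Fin 2 → RatFunc k := fun i => g (Ideal.Quotient.mk _ (X i))
  have hgx : g.comp (Ideal.Quotient.mkₐ k (Ideal.span {G})) = aeval x :=
    algHom_ext fun i => (aeval_X x i).symm
  refine ⟨x, ?_, ?_⟩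
  · have hGB : Ideal.Quotient.mkₐ k (Ideal.span {G}) G = 0 :=
      Ideal.Quotient.eq_zero_iff_mem.2 (Ideal.mem_span_singleton_self G)
    rw [← hgx, AlgHom.comp_apply, hGB, map_zero]
  · have hrange : g.range = Algebra.adjoin k (Set.range x) := by
      rw [Algebra.adjoin_range_eq_range_aeval, ← hgx, AlgHom.range_comp _ g,
        (AlgHom.range_eq_top _).2 (Ideal.Quotient.mkₐ_surjective k _), Algebra.map_top]
    rw [← IsFractionRing.algHom_fieldRange_eq_of_comp_eq_of_range_eq (K := FractionRing B)
      (f := (e : FractionRing B →ₐ[k] RatFunc k)) rfl hrange]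
    exact AlgHom.fieldRange_eq_top.2 e.surjective

theorem exists_notMem_range_of_adjoin_eq_top {ι L : Type*} [Field L] [Algebra k L] {x : ι → L}
    (hx : IntermediateField.adjoin k (Set.range x) = ⊤) {t : L}
    (ht : t ∉ (algebraMap k L).range) : ∃ i, x i ∉ (algebraMap k L).range := by
  by_contra! hconst
  have hbot : IntermediateField.adjoin k (Set.range x) = ⊥ := by
    rw [IntermediateField.adjoin_eq_bot_iff]
    rintro _ ⟨i, rfl⟩
    exact IntermediateField.mem_bot.2 (hconst i)
  exact ht (IntermediateField.mem_bot.1 ((hx.symm.trans hbot) ▸ IntermediateField.mem_top))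

theorem finrank_le_natDegree_of_adjoin_eq_top {K L : Type*} [Field K] [Field L] [Algebra K L]
    {p : K[X]} (hp : p ≠ 0) {x : L} (hx : Polynomial.aeval x p = 0) (htop : K⟮x⟯ = ⊤) :
    Module.finrank K L ≤ p.natDegree := by
  have hint : IsIntegral K x := IsAlgebraic.isIntegral ⟨p, hp, hx⟩
  rw [← IntermediateField.finrank_top', ← htop, IntermediateField.adjoin.finrank hint]
  exact Polynomial.natDegree_le_of_dvd (minpoly.dvd K x hx) hp

theorem finrank_adjoin_tail_le_degreeOf {L : Type*} [Field L] [Algebra k L] {n : ℕ}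
    {G : MvPolynomial (Fin (n + 1)) k} (hG : G ≠ 0) {x : Fin (n + 1) → L} (hx : aeval x G = 0)
    (hind : AlgebraicIndependent k (Fin.tail x))
    (htop : IntermediateField.adjoin k (Set.range x) = ⊤) :
    Module.finrank (IntermediateField.adjoin k (Set.range (Fin.tail x))) L ≤ G.degreeOf 0 := by
  let K := IntermediateField.adjoin k (Set.range (Fin.tail x))
  let y (i : Fin n) : K := ⟨Fin.tail x i, IntermediateField.subset_adjoin k _ ⟨i, rfl⟩⟩
  have hy : Function.Injective (aeval (R := k) y) := hind.of_comp K.val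
  have hp : (finSuccEquiv k n G).map (aeval (R := k) y).toRingHom ≠ 0 := by
    rw [Polynomial.map_ne_zero_iff hy]
    simpa using hG
  have haeval : ((Polynomial.aeval (R := K) (x 0)).restrictScalars k).comp
      ((Polynomial.mapAlgHom (aeval y)).comp (finSuccEquiv k n : _ →ₐ[k] _)) = aeval x := by
    refine algHom_ext fun i => ?_
    cases i using Fin.cases with
    | zero => simp [finSuccEquiv_X_zero]
    | succ j => simp [finSuccEquiv_X_succ, y, Fin.tail]
  have hKx : K⟮x 0⟯ = ⊤ := by
    rw [← IntermediateField.restrictScalars_eq_top_iff (K := k),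
      IntermediateField.restrictScalars_adjoin, eq_top_iff, ← htop,
      IntermediateField.adjoin_le_iff, Set.range_subset_iff]
    refine fun i => IntermediateField.subset_adjoin k _ ?_
    cases i using Fin.cases with
    | zero => exact Or.inr rfl
    | succ j => exact Or.inl (y j).2
  calc Module.finrank K L
      ≤ _ := finrank_le_natDegree_of_adjoin_eq_top hp ((DFunLike.congr_fun haeval G).trans hx) hKx
    _ ≤ (finSuccEquiv k n G).natDegree := Polynomial.natDegree_map_le
    _ = G.degreeOf 0 := natDegree_finSuccEquiv G

theorem max_natDegree_le_degreeOf_zero {G : MvPolynomial (Fin 2) k} (hG : G ≠ 0)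
    {x : Fin 2 → RatFunc k} (hx : aeval x G = 0)
    (htop : IntermediateField.adjoin k (Set.range x) = ⊤) :
    max (x 1).num.natDegree (x 1).denom.natDegree ≤ G.degreeOf 0 := by
  by_cases hc : ∃ c, x 1 = RatFunc.C c
  · obtain ⟨hnum, hdenom⟩ := (RatFunc.eq_C_iff (x 1)).1 hc
    simp [hnum, hdenom]
  have hind : AlgebraicIndependent k (Fin.tail x) :=
    algebraicIndependent_unique_type_iff.2 (RatFunc.transcendental_of_ne_C (x 1) hc)
  have hrange : Set.range (Fin.tail x) = {x 1} := Set.range_unique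
  rw [← RatFunc.finrank_eq_max_natDegree, ← hrange]
  exact finrank_adjoin_tail_le_degreeOf hG hx hind htop

theorem max_natDegree_le_totalDegree {G : MvPolynomial (Fin 2) k} (hG : G ≠ 0)
    {x : Fin 2 → RatFunc k} (hx : aeval x G = 0)
    (htop : IntermediateField.adjoin k (Set.range x) = ⊤) (i : Fin 2) :
    max (x i).num.natDegree (x i).denom.natDegree ≤ G.totalDegree := by
  let e : Equiv.Perm (Fin 2) := Equiv.swap 1 i
  have hGe : rename e G ≠ 0 := (map_ne_zero_iff _ (rename_injective _ e.injective)).2 hG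
  have hxe : aeval (x ∘ e) (rename e G) = 0 := by
    have hxee : (x ∘ e) ∘ e = x := funext fun j => congrArg x (Equiv.swap_apply_self 1 i j)
    rw [aeval_rename, hxee, hx]
  have htope : IntermediateField.adjoin k (Set.range (x ∘ e)) = ⊤ := by
    rwa [EquivLike.range_comp]
  calc max (x i).num.natDegree (x i).denom.natDegree
      = max ((x ∘ e) 1).num.natDegree ((x ∘ e) 1).denom.natDegree := by
        rw [Function.comp_apply, Equiv.swap_apply_left]
    _ ≤ (rename e G).degreeOf 0 := max_natDegree_le_degreeOf_zero hGe hxe htope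
    _ ≤ (rename e G).totalDegree := degreeOf_le_totalDegree _ _
    _ ≤ G.totalDegree := totalDegree_rename_le _ _

theorem exists_affineCoordinates_eq {σ : Type*} [Fintype σ] {x : σ → RatFunc k} {d : ℕ}
    (hx : ∀ i, max (x i).num.natDegree (x i).denom.natDegree ≤ d) :
    ∃ P : Option σ → k[X], (∀ s, (P s).natDegree ≤ Fintype.card σ * d) ∧
      affineCoordinates P = x := by
  classical
  let P : Option σ → k[X]
    | none => ∏ j, (x j).denom
    | some i => ∏ j, if j = i then (x j).num else (x j).denom
  refine ⟨P, fun s => ?_, funext fun i => ?_⟩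
  · have hprod (p : σ → k[X]) (hp : ∀ j, (p j).natDegree ≤ d) :
        (∏ j, p j).natDegree ≤ Fintype.card σ * d :=
      (Polynomial.natDegree_prod_le _ _).trans (Finset.sum_le_card_nsmul _ _ d fun j _ => hp j)
    cases s with
    | none => exact hprod _ fun j => (le_max_right _ _).trans (hx j)
    | some i =>
      refine hprod _ fun j => ?_
      split_ifs
      · exact (le_max_left _ _).trans (hx j)
      · exact (le_max_right _ _).trans (hx j)
  · have hdenom (j : σ) : algebraMap k[X] (RatFunc k) (x j).denom ≠ 0 :=
      RatFunc.algebraMap_ne_zero (x j).denom_ne_zero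
    simp only [affineCoordinates, P, map_prod]
    rw [← Finset.prod_div_distrib, Finset.prod_eq_single i]
    · rw [if_pos rfl, RatFunc.num_div_denom]
    · intro j _ hji
      rw [if_neg hji, div_self (hdenom j)]
    · simp

theorem isRationalQuotient_iff_exists_isRationalParametrization [IsAlgClosed k]
    {G : MvPolynomial (Fin 2) k} {d : ℕ} (hd : G.totalDegree ≤ d) :
    IsRationalQuotient G ↔ Irreducible G ∧ ∃ P : Option (Fin 2) → k[X],
      (∀ s, (P s).natDegree ≤ 2 * d) ∧ IsRationalParametrization G (affineCoordinates P) := by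
  refine ⟨fun h => ⟨h.1, ?_⟩, fun ⟨hG, P, _, hP⟩ => hP.isRationalQuotient hG⟩
  obtain ⟨x, hx, htop⟩ := h.exists_aeval_eq_zero_and_adjoin_eq_top
  have hX : (RatFunc.X : RatFunc k) ∉ (algebraMap k (RatFunc k)).range := by
    rintro ⟨c, hc⟩
    exact RatFunc.transcendental_X (hc ▸ isAlgebraic_algebraMap c)
  obtain ⟨P, hPd, rfl⟩ := exists_affineCoordinates_eq fun i =>
    (max_natDegree_le_totalDegree h.1.ne_zero hx htop i).trans hd
  exact ⟨P, by simpa using hPd, hx, exists_notMem_range_of_adjoin_eq_top htop hX⟩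

end PlaneCurves

theorem isConstructibleLocus_setOf_isRationalQuotient_map {k R : Type*} [Field k] [IsAlgClosed k]
    [CommRing R] [Algebra k R] [Algebra.FiniteType k R] (F : MvPolynomial (Fin 2) R) :
    IsConstructibleLocus {ψ : R →ₐ[k] k | IsRationalQuotient (F.map (ψ : R →+* k))} := by
  convert (isConstructibleLocus_setOf_irreducible_map (k := k) F).inter
    (isConstructibleLocus_setOf_exists_isRationalParametrization (k := k) F
      (2 * F.totalDegree)) using 1
  ext ψ
  exact isRationalQuotient_iff_exists_isRationalParametrization (totalDegree_map_le _ F)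

/-- The pencil `F - T` over `R[T]`, whose specialization at `T = c` is `F - c`. -/
noncomputable def pencil {R σ : Type*} [CommRing R] (F : MvPolynomial σ R) :
    MvPolynomial σ (Polynomial R) :=
  F.map Polynomial.C - MvPolynomial.C Polynomial.X

theorem map_evalRingHom_pencil {R σ : Type*} [CommRing R] (F : MvPolynomial σ R) (c : R) :
    (pencil F).map (Polynomial.evalRingHom c) = F - MvPolynomial.C c := by
  have hC : (Polynomial.evalRingHom c).comp Polynomial.C = RingHom.id R := by ext; simp
  simp [pencil, MvPolynomial.map_map, hC, MvPolynomial.map_id]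

theorem lemma2p3_general {k : Type*} [Field k] [IsAlgClosed k]
    (F : MvPolynomial (Fin 2) (Polynomial k)) :
    {c : k | IsRationalQuotient (F.map (Polynomial.evalRingHom c))}.Infinite ↔
      {c : k | ¬ IsRationalQuotient (F.map (Polynomial.evalRingHom c))}.Finite := by
  have hfin : {c : k | IsRationalQuotient (F.map (Polynomial.evalRingHom c))}.Finite ∨
      {c : k | ¬ IsRationalQuotient (F.map (Polynomial.evalRingHom c))}.Finite :=
    (isConstructibleLocus_setOf_isRationalQuotient_map (k := k) F).finite_or_finite_compl
  exact ⟨hfin.resolve_left, fun h => h.infinite_compl.mono fun c => not_not.1⟩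

theorem lemma2p3 {k : Type*} [Field k] [IsAlgClosed k] (F : MvPolynomial (Fin 2) k) :
    {c : k | IsRationalQuotient (F - MvPolynomial.C c)}.Infinite ↔
      {c : k | ¬ IsRationalQuotient (F - MvPolynomial.C c)}.Finite := by
  simpa only [map_evalRingHom_pencil] using lemma2p3_general (pencil F)
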